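/- Let $p$ be an odd prime and let $G$ be a finite $p$-group of nilpotency class two that can be generated by two elements. Let $D(G)$ be the least positive integer $k$ such that every sequence $g_1,\dots,g_k$ of $k$ elements of $G$ (repetitions allowed) admits $m\ge 1$ and indices $1\le i_1<i_2<\cdots<i_m\le k$ with $g_{i_1}g_{i_2}\cdots g_{i_m}=1$. Let $L(G)$ be the Loewy length of the group algebra $\mathbb{F}_pG$, that is, the least $n$ with $J^n=0$, where $J$ is the Jacobson radical of $\mathbb{F}_pG$. Write $o(x)$ for the order of $x$ and $[x,y]=x^{-1}y^{-1}xy$. Then $D(G)=L(G)$ in each of the following cases: 1. $G\cong G_1$ with $\gamma=1$, where $G_1=(\langle c\rangle\times\langle a\rangle)\rtimes\langle b\rangle$ with $[a,b]=c$, $[a,c]=[b,c]=1$, $o(a)=p^{\alpha}$, $o(b)=p^{\beta}$, $o(c)=p^{\gamma}$ for some integers $\alpha\ge\beta\ge\gamma\ge 1$; 2. $G\cong G_2$, where $G_2=\langle a\rangle\rtimes\langle b\rangle$ with $[a,b]=a^{p^{\alpha-\gamma}}$, $o(a)=p^{\alpha}$, $o(b)=p^{\beta}$, $o([a,b])=p^{\gamma}$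 for some integers $\alpha\ge 2\gamma$ and $\beta\ge\gamma\ge 1$; 3. $G\cong G_3$ with $\sigma=1$, where $G_3=(\langle c\rangle\times\langle a\rangle)\rtimes\langle b\rangle$ with $[a,b]=a^{p^{\alpha-\gamma}}c$, $[c,b]=a^{-p^{2(\alpha-\gamma)}}c^{-p^{\alpha-\gamma}}$, $o(a)=p^{\alpha}$, $o(b)=p^{\beta}$, $o(c)=p^{\sigma}$ for some integers $\beta\ge\gamma>\sigma\ge 1$ and $\alpha+\sigma\ge 2\gamma$. -/

import Mathlib

/-- The ordered Davenport constant `D(G)`: the least positive integer `k` such that every sequence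
of length `k` over `G` has a nonempty subsequence whose product, taken in the order of the
sequence, is `1`. (`List.Sublist` is the relation of being such a subsequence.) -/
noncomputable def orderedDavenport (G : Type*) [Group G] : ℕ :=
  sInf {k : ℕ | 0 < k ∧ ∀ S : List G, S.length = k →
    ∃ T : List G, T.Sublist S ∧ T ≠ [] ∧ T.prod = 1}

/-- The Loewy length `L(G)` of the group algebra `𝔽_p G`: the nilpotency index of its Jacobson
radical, i.e. the least `n` with `J ^ n = 0`. -/
noncomputable def loewyLength (p : ℕ) (G : Type*) [Group G] : ℕ :=
  sInf {n : ℕ | Ring.jacobson (MonoidAlgebra (ZMod p) G) ^ n = ⊥}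

/-- For a finite group the set defining `orderedDavenport` is nonempty, so `D(G)` is a genuine
minimum. -/
theorem orderedDavenport_mem (G : Type*) [Group G] [Finite G] :
    0 < orderedDavenport G ∧ ∀ S : List G, S.length = orderedDavenport G →
      ∃ T : List G, T.Sublist S ∧ T ≠ [] ∧ T.prod = 1 := by
  refine Nat.sInf_mem (s := {k : ℕ | 0 < k ∧ ∀ S : List G, S.length = k →
    ∃ T : List G, T.Sublist S ∧ T ≠ [] ∧ T.prod = 1}) ⟨Nat.card G, Nat.card_pos, fun S hS => ?_⟩
  have : Fintype G := Fintype.ofFinite G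
  obtain ⟨i, j, hij, h⟩ := Fintype.exists_ne_map_eq_of_card_lt
    (fun i : Fin (Nat.card G + 1) => (S.take i).prod) (by simp [Nat.card_eq_fintype_card])
  wlog hlt : i < j generalizing i j
  · exact this j i hij.symm h.symm (lt_of_le_of_ne (not_lt.1 hlt) hij.symm)
  have hlt' : (i : ℕ) < j := hlt
  have hj : (j : ℕ) ≤ S.length := by have := j.2; omega
  refine ⟨(S.take j).drop i, (List.drop_sublist _ _).trans (List.take_sublist _ _), ?_, ?_⟩
  · intro h0
    have := congrArg List.length h0
    simp at this
    omega
  · have h1 := List.prod_take_mul_prod_drop (S.take j) i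
    rw [List.take_take, min_eq_left hlt'.le] at h1
    rw [h] at h1
    exact mul_eq_left.1 h1

/-- For a finite group the set defining `loewyLength` is nonempty, so `L(G)` is a genuine
minimum. -/
theorem loewyLength_mem (p : ℕ) [Fact p.Prime] (G : Type*) [Group G] [Finite G] :
    Ring.jacobson (MonoidAlgebra (ZMod p) G) ^ loewyLength p G = ⊥ := by
  have : IsArtinianRing (MonoidAlgebra (ZMod p) G) := IsArtinianRing.of_finite (ZMod p) _
  exact Nat.sInf_mem (s := {n : ℕ | Ring.jacobson (MonoidAlgebra (ZMod p) G) ^ n = ⊥})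
    IsSemiprimaryRing.isNilpotent

/-- The commutator `[x, y] = x⁻¹ y⁻¹ x y`. -/
def grpComm {G : Type*} [Group G] (x y : G) : G := x⁻¹ * y⁻¹ * x * y

/-- `G = (⟨c⟩ × ⟨a⟩) ⋊ ⟨b⟩` as an internal direct and semidirect product. -/
structure IsInternalProduct {G : Type*} [Group G] (a b c : G) : Prop where
  commute : Commute c a
  disjoint : Disjoint (Subgroup.zpowers c) (Subgroup.zpowers a)
  normal : (Subgroup.zpowers c ⊔ Subgroup.zpowers a).Normal
  isComplement : Subgroup.IsComplement' (Subgroup.zpowers c ⊔ Subgroup.zpowers a)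
    (Subgroup.zpowers b)

/-- `G ≅ G₁(α, β, γ)`: `G = (⟨c⟩ × ⟨a⟩) ⋊ ⟨b⟩` with `[a,b] = c`, `[a,c] = [b,c] = 1`,
`o(a) = p^α`, `o(b) = p^β`, `o(c) = p^γ`, where `α ≥ β ≥ γ ≥ 1`. -/
def IsTypeG₁ (p α β γ : ℕ) (G : Type*) [Group G] : Prop :=
  β ≤ α ∧ γ ≤ β ∧ 1 ≤ γ ∧
  ∃ a b c : G, IsInternalProduct a b c ∧
    grpComm a b = c ∧ grpComm a c = 1 ∧ grpComm b c = 1 ∧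
    orderOf a = p ^ α ∧ orderOf b = p ^ β ∧ orderOf c = p ^ γ

/-- `G ≅ G₂(α, β, γ)`: `G = ⟨a⟩ ⋊ ⟨b⟩` with `[a,b] = a^(p^(α-γ))`, `o(a) = p^α`, `o(b) = p^β`,
`o([a,b]) = p^γ`, where `α ≥ 2γ` and `β ≥ γ ≥ 1`. -/
def IsTypeG₂ (p α β γ : ℕ) (G : Type*) [Group G] : Prop :=
  2 * γ ≤ α ∧ γ ≤ β ∧ 1 ≤ γ ∧
  ∃ a b : G, (Subgroup.zpowers a).Normal ∧
    Subgroup.IsComplement' (Subgroup.zpowers a) (Subgroup.zpowers b) ∧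
    grpComm a b = a ^ p ^ (α - γ) ∧
    orderOf a = p ^ α ∧ orderOf b = p ^ β ∧ orderOf (grpComm a b) = p ^ γ

/-- `G ≅ G₃(α, β, γ, σ)`: `G = (⟨c⟩ × ⟨a⟩) ⋊ ⟨b⟩` with `[a,b] = a^(p^(α-γ)) c`,
`[c,b] = a^(-p^(2(α-γ))) c^(-p^(α-γ))`, `o(a) = p^α`, `o(b) = p^β`, `o(c) = p^σ`, where
`β ≥ γ > σ ≥ 1` and `α + σ ≥ 2γ` (so that `α > γ`). -/
def IsTypeG₃ (p α β γ σ : ℕ) (G : Type*) [Group G] : Prop :=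
  γ ≤ β ∧ σ < γ ∧ 1 ≤ σ ∧ 2 * γ ≤ α + σ ∧
  ∃ a b c : G, IsInternalProduct a b c ∧
    grpComm a b = a ^ p ^ (α - γ) * c ∧
    grpComm c b = (a ^ p ^ (2 * (α - γ)))⁻¹ * (c ^ p ^ (α - γ))⁻¹ ∧
    orderOf a = p ^ α ∧ orderOf b = p ^ β ∧ orderOf c = p ^ σ

/-! Put N = |S| + 1 for a suitable sequence S with no nonempty ordered product equal to 1. The claim
is N ≤ D(G) ≤ L(G) ≤ N (`orderedDavenport_eq_loewyLength`). D ≤ L: if no nonempty subsequence has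
product 1, then ∏(1 - g_i) has coefficient 1 at the identity, so it is a nonzero element of a power
of J. L ≤ N (`pow_ker_augmentation_eq_bot`): let d = [a,b], which is central, and A = a - 1, B = b -
1, C = d - 1 with weights 1, 1, 2. Powers of the augmentation ideal lie in the weight filtration.
Frobenius turns the orders of a and b into A^(p^α) = B^(p^β) = 0, and writes C^(p^e) as a power of A
of no smaller weight. Hence nonzero monomials have weight at most (p^α - 1) + (p^β - 1) + 2(p^e -
1), with e = 1 in cases 1 and 3 and e = 0 in case 2. N ≤ D: p^β - 1 copies of b and p^α - 1 of a
suffice in case 2. In the other cases 2(p - 1) further terms are added; a product equal to 1 would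
give a zero mod p of an anisotropic binary quadratic form (`eq_nil_of_sublist_four_blocks`). -/

/-! ### The weight filtration -/

section WeightFiltration

variable {k R : Type*} [CommRing k] [Ring R] [Algebra k R]

/-- The span of the monomials `B ^ j * A ^ i * C ^ l` of weight at least `n`, where `A` and `B`
have weight one and `C` has weight two. -/
def weightSpan (k : Type*) {R : Type*} [CommRing k] [Ring R] [Algebra k R] (A B C : R) (n : ℕ) :
    Submodule k R :=
  Submodule.span k {x | ∃ i j l : ℕ, n ≤ j + i + 2 * l ∧ x = B ^ j * A ^ i * C ^ l}

theorem monomial_mem_weightSpan (A B C : R) {n i j l : ℕ} (h : n ≤ j + i + 2 * l) :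
    B ^ j * A ^ i * C ^ l ∈ weightSpan k A B C n :=
  Submodule.subset_span ⟨i, j, l, h, rfl⟩

theorem weightSpan_antitone (A B C : R) : Antitone (weightSpan k A B C) := by
  intro m n hmn
  refine Submodule.span_mono ?_
  rintro x ⟨i, j, l, h, rfl⟩
  exact ⟨i, j, l, hmn.trans h, rfl⟩

theorem mul_mem_weightSpan_of_monomial {A B C x : R} {m n : ℕ}
    (h : ∀ i j l : ℕ, n ≤ j + i + 2 * l → x * (B ^ j * A ^ i * C ^ l) ∈ weightSpan k A B C m)
    {w : R} (hw : w ∈ weightSpan k A B C n) : x * w ∈ weightSpan k A B C m := by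
  have : weightSpan k A B C n ≤ (weightSpan k A B C m).comap (LinearMap.mulLeft k x) := by
    refine Submodule.span_le.2 ?_
    rintro y ⟨i, j, l, hy, rfl⟩
    exact h i j l hy
  exact this hw

theorem right_mul_mem_weightSpan {A B C w : R} {n : ℕ} (hw : w ∈ weightSpan k A B C n) :
    B * w ∈ weightSpan k A B C (n + 1) := by
  refine mul_mem_weightSpan_of_monomial (fun i j l h => ?_) hw
  rw [← mul_assoc, ← mul_assoc, ← pow_succ']
  exact monomial_mem_weightSpan A B C (by omega)

theorem central_mul_mem_weightSpan {A B C w : R} (hC : ∀ x, Commute C x) {n : ℕ}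
    (hw : w ∈ weightSpan k A B C n) : C * w ∈ weightSpan k A B C (n + 2) := by
  refine mul_mem_weightSpan_of_monomial (fun i j l h => ?_) hw
  rw [(hC _).eq, mul_assoc, ← pow_succ]
  exact monomial_mem_weightSpan A B C (by omega)

/-- Moving A past B costs a term containing C, whose weight two matches that of AB; the factors 1 +
A and 1 + B never lower the weight. The relation `hAB` is ab = bad rewritten in A, B, C. -/
theorem left_mul_mem_weightSpan {A B C w : R} (hC : ∀ x, Commute C x)
    (hAB : A * B = B * A + (1 + B) * (1 + A) * C) {n : ℕ} (hw : w ∈ weightSpan k A B C n) :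
    A * w ∈ weightSpan k A B C (n + 1) := by
  refine mul_mem_weightSpan_of_monomial (fun i j l h => ?_) hw
  refine weightSpan_antitone A B C (Nat.succ_le_succ h) ?_
  clear h
  induction j with
  | zero =>
    have : A * (B ^ 0 * A ^ i * C ^ l) = B ^ 0 * A ^ (i + 1) * C ^ l := by
      rw [pow_succ']; noncomm_ring
    rw [this]
    exact monomial_mem_weightSpan A B C (by omega)
  | succ j ih =>
    set m := B ^ j * A ^ i * C ^ l with hm
    have key : A * (B ^ (j + 1) * A ^ i * C ^ l) =
        B * (A * m) + (C * (m + A * m) + B * (C * (m + A * m))) := by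
      have h1 : A * (B ^ (j + 1) * A ^ i * C ^ l) = A * B * m := by
        rw [hm, pow_succ']; simp only [mul_assoc]
      rw [h1, hAB, ← (hC ((1 + B) * (1 + A))).eq, ← mul_assoc B C, ← (hC B).eq]
      noncomm_ring
    have hmm : m ∈ weightSpan k A B C (j + i + 2 * l) := monomial_mem_weightSpan A B C le_rfl
    have h2 : C * (m + A * m) ∈ weightSpan k A B C (j + i + 2 * l + 2) :=
      central_mul_mem_weightSpan hC
        (add_mem hmm (weightSpan_antitone A B C (Nat.le_succ _) ih))
    rw [key, show (j + 1 + i + 2 * l).succ = j + i + 2 * l + 2 by omega]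
    exact add_mem (right_mul_mem_weightSpan ih)
      (add_mem h2 (weightSpan_antitone A B C (Nat.le_succ _) (right_mul_mem_weightSpan h2)))

/-- If `A ^ P = B ^ Q = 0` and `C ^ r` is a power of `A` of no smaller weight, then monomials of
large weight vanish. -/
theorem weightSpan_eq_bot {A B C : R} {P Q r s n : ℕ} (hr : 0 < r)
    (hrs : 2 * r ≤ s) (hA : A ^ P = 0) (hB : B ^ Q = 0) (hCA : C ^ r = A ^ s)
    (hn : P + Q + 2 * r ≤ n + 3) : weightSpan k A B C n = ⊥ := by
  refine Submodule.span_eq_bot.2 ?_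
  rintro x ⟨i, j, l, h, rfl⟩
  induction l using Nat.strong_induction_on generalizing i with
  | _ l ih =>
    rcases lt_or_ge l r with hl | hl
    · rcases le_or_gt P i with hi | hi
      · rw [pow_eq_zero_of_le hi hA]; simp
      · rw [pow_eq_zero_of_le (show Q ≤ j by omega) hB]; simp
    -- Trading C^r for A^s lowers the exponent of C, and the weight does not drop since s ≥ 2r.
    · have h1 : B ^ j * A ^ i * C ^ l = B ^ j * A ^ (i + s) * C ^ (l - r) := by
        conv_lhs => rw [← Nat.add_sub_cancel' hl, pow_add, hCA]
        rw [pow_add]; simp only [mul_assoc]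
      rw [h1]
      exact ih (l - r) (by omega) (i + s) (by omega)

end WeightFiltration

/-! ### The augmentation ideal -/

section Augmentation

open MonoidAlgebra

variable {p : ℕ} {G : Type*} [Group G]

/-- The augmentation map of the group algebra over `ZMod p`. -/
noncomputable def augmentation (p : ℕ) (G : Type*) [Group G] :
    MonoidAlgebra (ZMod p) G →+* ZMod p :=
  (MonoidAlgebra.lift (ZMod p) (ZMod p) G 1).toRingHom

theorem augmentation_single (g : G) (r : ZMod p) : augmentation p G (single g r) = r := by
  simp [augmentation]

theorem of_sub_one_mem_ker (g : G) :
    of (ZMod p) G g - 1 ∈ RingHom.ker (augmentation p G) := by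
  rw [RingHom.mem_ker, map_sub, map_one, of_apply, augmentation_single, sub_self]

theorem sub_augmentation_mem_span (x : MonoidAlgebra (ZMod p) G) :
    x - algebraMap (ZMod p) _ (augmentation p G x) ∈
      Submodule.span (ZMod p) (Set.range fun g : G => of (ZMod p) G g - 1) := by
  induction x using MonoidAlgebra.induction_linear with
  | zero => simp
  | add x y hx hy =>
    rw [map_add, map_add, add_sub_add_comm]
    exact add_mem hx hy
  | single g r =>
    have : single g r - algebraMap (ZMod p) (MonoidAlgebra (ZMod p) G)
        (augmentation p G (single g r)) = r • (of (ZMod p) G g - 1) := by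
      rw [augmentation_single, Algebra.algebraMap_eq_smul_one, smul_sub, of_apply, smul_single,
        smul_eq_mul, mul_one]
    rw [this]
    exact Submodule.smul_mem _ _ (Submodule.subset_span ⟨g, rfl⟩)

/-- If a decreasing filtration of `𝔽_p G` starts at `1` and is shifted by `a - 1` and `b - 1` for
generators `a`, `b`, then it contains the powers of the augmentation ideal. -/
theorem pow_ker_augmentation_le [Finite G] {a b : G}
    (hgen : Subgroup.closure {a, b} = ⊤) (W : ℕ → Submodule (ZMod p) (MonoidAlgebra (ZMod p) G))
    (hW : Antitone W) (h1 : 1 ∈ W 0)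
    (ha : ∀ n, ∀ w ∈ W n, (of (ZMod p) G a - 1) * w ∈ W (n + 1))
    (hb : ∀ n, ∀ w ∈ W n, (of (ZMod p) G b - 1) * w ∈ W (n + 1)) (n : ℕ)
    {x : MonoidAlgebra (ZMod p) G} (hx : x ∈ RingHom.ker (augmentation p G) ^ n) : x ∈ W n := by
  have hg : ∀ g : G, ∀ n, ∀ w ∈ W n, (of (ZMod p) G g - 1) * w ∈ W (n + 1) := by
    intro g
    -- As G is finite, a and b generate it as a monoid, so inverses need no treatment.
    have hmem : g ∈ Submonoid.closure {a, b} := by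
      rw [← Subgroup.closure_toSubmonoid_of_finite, hgen]; trivial
    induction hmem using Submonoid.closure_induction with
    | mem g hg =>
      rcases hg with rfl | rfl
      · exact ha
      · exact hb
    | one => intro n w _; rw [map_one, sub_self, zero_mul]; exact zero_mem _
    | mul g h _ _ ihg ihh =>
      intro n w hw
      have : (of (ZMod p) G (g * h) - 1) * w = (of (ZMod p) G g - 1) * ((of (ZMod p) G h - 1) * w)
          + (of (ZMod p) G g - 1) * w + (of (ZMod p) G h - 1) * w := by
        rw [map_mul]; noncomm_ring
      rw [this]
      exact add_mem (add_mem (hW (Nat.le_succ _) (ihg _ _ (ihh _ _ hw))) (ihg _ _ hw))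
        (ihh _ _ hw)
  have hspan : ∀ x ∈ Submodule.span (ZMod p) (Set.range fun g : G => of (ZMod p) G g - 1),
      ∀ n, ∀ w ∈ W n, x * w ∈ W (n + 1) := by
    intro x hx n w hw
    induction hx using Submodule.span_induction with
    | mem x hx => obtain ⟨g, rfl⟩ := hx; exact hg g n w hw
    | zero => simp
    | add x y _ _ hx hy => rw [add_mul]; exact add_mem hx hy
    | smul r x _ hx => rw [smul_mul_assoc]; exact Submodule.smul_mem _ _ hx
  induction n generalizing x with
  | zero =>
    have h2 := hspan _ (sub_augmentation_mem_span x) 0 1 h1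
    rw [mul_one] at h2
    have h3 := add_mem (hW (Nat.zero_le 1) h2) (Submodule.smul_mem _ (augmentation p G x) h1)
    rwa [Algebra.algebraMap_eq_smul_one, sub_add_cancel] at h3
  | succ n ih =>
    rw [Ideal.IsTwoSided.pow_succ] at hx
    induction hx using Submodule.smul_induction_on' with
    | smul y hy z hz =>
      have h2 := sub_augmentation_mem_span y
      rw [RingHom.mem_ker.1 hy, map_zero, sub_zero] at h2
      exact hspan y h2 n z (ih hz)
    | add y _ z _ hy hz => exact add_mem hy hz

variable [Fact p.Prime]

theorem jacobson_le_ker_augmentation :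
    Ring.jacobson (MonoidAlgebra (ZMod p) G) ≤ RingHom.ker (augmentation p G) := by
  have : RingHomSurjective (augmentation p G) := ⟨fun r => ⟨single 1 r, augmentation_single 1 r⟩⟩
  refine (Ring.le_comap_jacobson (augmentation p G)).trans ?_
  have : (⊥ : Ideal (ZMod p)).IsMaximal := Ideal.bot_isMaximal
  exact Ideal.comap_mono (Ring.jacobson_le_of_isMaximal ⊥)

end Augmentation

/-- If I were not inside a maximal m, then m + I = R would force m + I^n = R, that is, m = R. -/
theorem le_jacobson_of_pow_eq_bot {R : Type*} [Ring R] {I : Ideal R} [I.IsTwoSided] {n : ℕ}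
    (h : I ^ n = ⊥) : I ≤ Ring.jacobson R := by
  rw [Ring.jacobson_eq_sInf_isMaximal]
  refine le_sInf fun m hm => ?_
  by_contra hI
  have h1 : m ⊔ I = ⊤ := (Ideal.isMaximal_def.1 hm).2 _ (left_lt_sup.2 hI)
  have h2 := Ideal.sup_pow_eq_top' (n := n) h1
  rw [h, sup_bot_eq] at h2
  exact hm.ne_top h2

/-! ### The ordered Davenport constant and the Loewy length -/

section Davenport

open MonoidAlgebra

variable {p : ℕ} {G : Type*} [Group G]

/-- In the expanded product the empty subsequence contributes 1, and each other one contributes its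
ordered product up to sign. -/
theorem prod_one_sub_of_sub_one_mem_span (S : List G) :
    (S.map fun g => 1 - of (ZMod p) G g).prod - 1 ∈
      Submodule.span (ZMod p) {x | ∃ T : List G, T.Sublist S ∧ T ≠ [] ∧
        x = of (ZMod p) G T.prod} := by
  induction S with
  | nil => simp
  | cons g S ih =>
    set Q := (S.map fun g => 1 - of (ZMod p) G g).prod - 1 with hQ
    have h1 : ((g :: S).map fun g => 1 - of (ZMod p) G g).prod - 1 =
        Q - of (ZMod p) G g - of (ZMod p) G g * Q := by
      rw [List.map_cons, List.prod_cons, hQ]; noncomm_ring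
    rw [h1]
    refine sub_mem (sub_mem (Submodule.span_mono ?_ ih) (Submodule.subset_span ?_)) ?_
    · rintro x ⟨T, hT, hT', rfl⟩
      exact ⟨T, hT.cons g, hT', rfl⟩
    · exact ⟨[g], by simp, by simp, by simp⟩
    · have h2 := Submodule.mem_map_of_mem (f := LinearMap.mulLeft (ZMod p) (of (ZMod p) G g)) ih
      rw [Submodule.map_span] at h2
      refine Submodule.span_mono ?_ h2
      rintro _ ⟨_, ⟨T, hT, hT', rfl⟩, rfl⟩
      exact ⟨g :: T, hT.cons_cons g, by simp, by simp⟩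

theorem list_prod_map_mem_pow {R α : Type*} [Ring R] {I : Ideal R} [I.IsTwoSided] {f : α → R}
    (hf : ∀ x, f x ∈ I) (S : List α) : (S.map f).prod ∈ I ^ S.length := by
  induction S with
  | nil => simp [Submodule.pow_zero, Ideal.one_eq_top]
  | cons x S ih =>
    rw [List.map_cons, List.prod_cons, List.length_cons, Ideal.IsTwoSided.pow_succ]
    exact Ideal.mul_mem_mul (hf x) ih

theorem exists_sublist_prod_eq_one [Fact p.Prime] {I : Ideal (MonoidAlgebra (ZMod p) G)}
    [I.IsTwoSided] (hI : ∀ g : G, 1 - of (ZMod p) G g ∈ I) (S : List G)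
    (h : I ^ S.length = ⊥) : ∃ T : List G, T.Sublist S ∧ T ≠ [] ∧ T.prod = 1 := by
  by_contra! hS
  have h0 : (S.map fun g => 1 - of (ZMod p) G g).prod = 0 := by
    have := list_prod_map_mem_pow hI S
    rwa [h, Submodule.mem_bot] at this
  have h1 := prod_one_sub_of_sub_one_mem_span (p := p) S
  rw [h0, zero_sub, Submodule.neg_mem_iff] at h1
  have h2 : ∀ x ∈ Submodule.span (ZMod p) {x | ∃ T : List G, T.Sublist S ∧ T ≠ [] ∧
      x = of (ZMod p) G T.prod}, x.coeff 1 = 0 := by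
    intro x hx
    induction hx using Submodule.span_induction with
    | mem x hx =>
      obtain ⟨T, hT, hT', rfl⟩ := hx
      simp [of_apply, hS T hT hT']
    | zero => simp
    | add x y _ _ hx hy => simp [hx, hy]
    | smul r x _ hx => simp [hx]
  have h3 := h2 1 h1
  simp [MonoidAlgebra.one_def] at h3

theorem lt_orderedDavenport [Finite G] {S : List G}
    (hS : ∀ T : List G, T.Sublist S → T.prod = 1 → T = []) :
    S.length < orderedDavenport G := by
  by_contra! hlt
  obtain ⟨T, hT, hT', h⟩ := (orderedDavenport_mem G).2 (S.take (orderedDavenport G)) (by simpa)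
  exact hT' (hS T (hT.trans (List.take_sublist _ _)) h)

theorem orderedDavenport_eq_loewyLength [Fact p.Prime] [Finite G] {S : List G}
    (hS : ∀ T : List G, T.Sublist S → T.prod = 1 → T = [])
    (hI : RingHom.ker (augmentation p G) ^ (S.length + 1) = ⊥) :
    orderedDavenport G = loewyLength p G := by
  have hle := le_jacobson_of_pow_eq_bot hI
  have hL : loewyLength p G ≤ S.length + 1 := by
    refine Nat.sInf_le ?_
    rw [Set.mem_ofPred_eq, eq_bot_iff, ← hI]
    exact Ideal.pow_right_mono jacobson_le_ker_augmentation _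
  have hmem (g : G) : 1 - of (ZMod p) G g ∈ Ring.jacobson (MonoidAlgebra (ZMod p) G) := by
    rw [← neg_sub, Submodule.neg_mem_iff]
    exact hle (of_sub_one_mem_ker g)
  -- `orderedDavenport` is a minimum over positive lengths only.
  have hpos : 0 < loewyLength p G := by
    rcases Nat.eq_zero_or_pos (loewyLength p G) with h0 | h0
    · have := loewyLength_mem p G
      rw [h0, Submodule.pow_zero, Ideal.one_eq_top] at this
      exact absurd this top_ne_bot
    · exact h0
  refine le_antisymm (Nat.sInf_le ⟨hpos, fun S hS => ?_⟩) (hL.trans (lt_orderedDavenport hS))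
  exact exists_sublist_prod_eq_one hmem S (hS ▸ loewyLength_mem p G)

end Davenport

/-! ### Groups with two generators and central commutator -/

section TwoGenerators

open scoped commutatorElement

variable {G : Type*} [Group G]

theorem mul_eq_mul_mul_grpComm (a b : G) : a * b = b * a * grpComm a b := by
  simp only [grpComm]; group

theorem commute_grpComm_of_nilpotencyClass_eq_two [Group.IsNilpotent G]
    (h : Group.nilpotencyClass G = 2) (a b g : G) :
    Commute (grpComm a b) g := by
  have h1 : ⁅⁅a⁻¹, b⁻¹⁆, g⁆ ∈ (⊤ : Subgroup G).lowerCentralSeries 2 :=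
    Subgroup.commutator_mem_commutator
      (Subgroup.commutator_mem_commutator (Subgroup.mem_top _) (Subgroup.mem_top _))
      (Subgroup.mem_top _)
  rw [← h, Subgroup.lowerCentralSeries_nilpotencyClass, Subgroup.mem_bot,
    commutatorElement_eq_one_iff_commute] at h1
  -- The bracket here is ⁅x, y⁆ = x y x⁻¹ y⁻¹, hence the inverses.
  have h2 : grpComm a b = ⁅a⁻¹, b⁻¹⁆ := by simp [grpComm, commutatorElement_def]
  rwa [h2]

theorem pow_mul_pow_of_commutator {a b d : G} (hd : ∀ g, Commute d g) (h : a * b = b * a * d)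
    (m n : ℕ) : a ^ m * b ^ n = b ^ n * a ^ m * d ^ (m * n) := by
  have h1 : ∀ n : ℕ, a * b ^ n = b ^ n * a * d ^ n := by
    intro n
    induction n with
    | zero => simp
    | succ n ih =>
      rw [pow_succ b, ← mul_assoc, ih, mul_assoc, ((hd b).pow_left n).eq, ← mul_assoc,
        mul_assoc (b ^ n), h, pow_succ' d]
      simp only [mul_assoc]
  induction m with
  | zero => simp
  | succ m ih =>
    rw [pow_succ a, mul_assoc, h1, ← mul_assoc, ← mul_assoc, ih, mul_assoc (b ^ n * a ^ m),
      ((hd a).pow_left (m * n)).eq, add_mul, one_mul, pow_add]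
    simp only [mul_assoc]

theorem normalForm_mul {a b d : G} (hd : ∀ g, Commute d g) (h : a * b = b * a * d)
    (u v w u' v' w' : ℕ) :
    (b ^ u * a ^ v * d ^ w) * (b ^ u' * a ^ v' * d ^ w') =
      b ^ (u + u') * a ^ (v + v') * d ^ (w + w' + v * u') := by
  have h1 : (b ^ u * a ^ v * d ^ w) * (b ^ u' * a ^ v' * d ^ w') =
      b ^ u * (a ^ v * b ^ u') * a ^ v' * (d ^ w * d ^ w') := by
    rw [mul_assoc, ← mul_assoc (d ^ w), ((hd (b ^ u' * a ^ v')).pow_left w).eq]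
    simp only [mul_assoc]
  rw [h1, pow_mul_pow_of_commutator hd h, ← mul_assoc (b ^ u), mul_assoc _ (d ^ (v * u')),
    ((hd (a ^ v')).pow_left (v * u')).eq, add_comm (w + w'), pow_add b, pow_add a, pow_add d,
    pow_add d]
  simp only [mul_assoc]

/-- Each of the `k.choose 2` pairs of factors contributes d^(uv) when a^v passes b^u. -/
theorem normalForm_pow {a b d : G} (hd : ∀ g, Commute d g) (h : a * b = b * a * d)
    (u v w k : ℕ) :
    (b ^ u * a ^ v * d ^ w) ^ k =
      b ^ (u * k) * a ^ (v * k) * d ^ (w * k + u * v * k.choose 2) := by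
  induction k with
  | zero => simp
  | succ k ih =>
    rw [pow_succ, ih, normalForm_mul hd h]
    have : (k + 1).choose 2 = k + k.choose 2 := by
      rw [Nat.choose_succ_succ' k 1, Nat.choose_one_right]
    rw [this]
    congr 2
    ring

theorem two_mul_choose_two_add (k : ℕ) : 2 * k.choose 2 + k = k ^ 2 := by
  induction k with
  | zero => simp
  | succ k ih =>
    rw [Nat.choose_succ_succ' k 1, Nat.choose_one_right]
    linarith [ih]

theorem sublist_replicate_append_replicate {α : Type*} {x y : α} {m n : ℕ} {T : List α}
    (h : T.Sublist (List.replicate m x ++ List.replicate n y)) :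
    ∃ i ≤ m, ∃ j ≤ n, T = List.replicate i x ++ List.replicate j y := by
  obtain ⟨T₁, T₂, rfl, h₁, h₂⟩ := List.sublist_append_iff.1 h
  obtain ⟨i, hi, rfl⟩ := List.sublist_replicate_iff.1 h₁
  obtain ⟨j, hj, rfl⟩ := List.sublist_replicate_iff.1 h₂
  exact ⟨i, hi, j, hj, rfl⟩

theorem eq_nil_of_sublist_two_blocks {a b : G} {m n : ℕ}
    (hba : ∀ j i : ℕ, b ^ j * a ^ i = 1 → n ∣ j ∧ m ∣ i) (hm : 0 < m) (hn : 0 < n)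
    {T : List G} (hT : T.Sublist (List.replicate (n - 1) b ++ List.replicate (m - 1) a))
    (h1 : T.prod = 1) : T = [] := by
  obtain ⟨j, hj, i, hi, rfl⟩ := sublist_replicate_append_replicate hT
  rw [List.prod_append, List.prod_replicate, List.prod_replicate] at h1
  obtain ⟨h2, h3⟩ := hba j i h1
  rw [Nat.eq_zero_of_dvd_of_lt h2 (by omega), Nat.eq_zero_of_dvd_of_lt h3 (by omega)]
  rfl

/-- The form `(k + l) ^ 2 - η * l ^ 2` is anisotropic when `η = 1 - z` is not a square. -/
theorem eq_zero_of_form_eq_zero {F : Type*} [Field F] {z k l : F} (hz : ¬ IsSquare (1 - z))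
    (h : k ^ 2 + 2 * k * l + z * l ^ 2 = 0) : k = 0 ∧ l = 0 := by
  have hl : l = 0 := by
    by_contra hl
    refine hz ⟨(k + l) / l, ?_⟩
    field_simp
    linear_combination -h
  subst hl
  simpa using h

/-- The sequence `b, …, b, a, …, a, x, …, x, y, …, y` with `x = b a d ^ e`,
`y = b ^ z a d ^ (e z)`, where `1 - z` is a quadratic non-residue and `2 e = p + 1`, has no
nonempty ordered subsequence with product one. -/
theorem eq_nil_of_sublist_four_blocks {p : ℕ} [Fact p.Prime] {a b d : G} {m n z e : ℕ}
    (hd : ∀ g, Commute d g) (h : a * b = b * a * d)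
    (hrel : ∀ u v w : ℕ, b ^ u * a ^ v * d ^ w = 1 → p ∣ v ∧ p ∣ w)
    (hba : ∀ j i : ℕ, b ^ j * a ^ i = 1 → n ∣ j ∧ m ∣ i) (hm : 0 < m) (hn : 0 < n)
    (hz : ¬ IsSquare (1 - (z : ZMod p))) (he : 2 * e = p + 1)
    {T : List G} (hT : T.Sublist ((List.replicate (n - 1) b ++ List.replicate (m - 1) a) ++
      (List.replicate (p - 1) (b ^ 1 * a ^ 1 * d ^ e) ++
        List.replicate (p - 1) (b ^ z * a ^ 1 * d ^ (e * z)))))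
    (h1 : T.prod = 1) : T = [] := by
  obtain ⟨T₁, T₂, rfl, hT₁, hT₂⟩ := List.sublist_append_iff.1 hT
  obtain ⟨k, hk, l, hl, rfl⟩ := sublist_replicate_append_replicate hT₂
  obtain ⟨j, hj, i, hi, rfl⟩ := sublist_replicate_append_replicate hT₁
  have hpp := (Fact.out : p.Prime).pos
  have h2 := h1
  simp only [List.prod_append, List.prod_replicate] at h2
  have h3 : b ^ j * a ^ i = b ^ j * a ^ i * d ^ 0 := by simp
  rw [normalForm_pow hd h, normalForm_pow hd h, normalForm_mul hd h, h3, normalForm_mul hd h] at h2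
  obtain ⟨hv, hw⟩ := hrel _ _ _ h2
  have hv' := (ZMod.natCast_eq_zero_iff _ p).2 hv
  have hw' := (ZMod.natCast_eq_zero_iff _ p).2 hw
  have he' : 2 * (e : ZMod p) = 1 := by
    have := congrArg (Nat.cast : ℕ → ZMod p) he
    push_cast at this
    simpa using this
  have hck : 2 * (k.choose 2 : ZMod p) + k = k ^ 2 := mod_cast
    congrArg (Nat.cast : ℕ → ZMod p) (two_mul_choose_two_add k)
  have hcl : 2 * (l.choose 2 : ZMod p) + l = l ^ 2 := mod_cast
    congrArg (Nat.cast : ℕ → ZMod p) (two_mul_choose_two_add l)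
  push_cast at hv' hw'
  -- Mod p, the exponent of a gives i = -(k + l). Since e is 1/2, it turns the binomials into k²/2
  -- and l²/2, and -2 times the exponent of d becomes the form.
  have hq : (k : ZMod p) ^ 2 + 2 * k * l + z * l ^ 2 = 0 := by
    linear_combination (-2) * hw' + 2 * (k + z * l) * hv' + (k + z * l) * he' + hck + z * hcl
  obtain ⟨hk0, hl0⟩ := eq_zero_of_form_eq_zero hz hq
  have hk0' := Nat.eq_zero_of_dvd_of_lt ((ZMod.natCast_eq_zero_iff _ p).1 hk0) (by omega)
  have hl0' := Nat.eq_zero_of_dvd_of_lt ((ZMod.natCast_eq_zero_iff _ p).1 hl0) (by omega)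
  subst hk0' hl0'
  simp only [List.replicate_zero, List.append_nil] at h1 ⊢
  refine eq_nil_of_sublist_two_blocks hba hm hn ?_ h1
  exact hT₁

theorem exists_natCast_one_sub_not_isSquare {p : ℕ} [Fact p.Prime] (hp : Odd p) :
    ∃ z : ℕ, ¬ IsSquare (1 - (z : ZMod p)) := by
  have h2 : ringChar (ZMod p) ≠ 2 := by
    rw [ZMod.ringChar_zmod_n]
    rintro rfl
    exact absurd hp (by decide)
  obtain ⟨η, hη⟩ := FiniteField.exists_nonsquare h2
  refine ⟨(1 - η).val, ?_⟩
  rwa [ZMod.natCast_zmod_val, sub_sub_cancel]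

open MonoidAlgebra in
theorem pow_ker_augmentation_eq_bot {p : ℕ} [Fact p.Prime] [Finite G] {a b d : G}
    (hgen : Subgroup.closure {a, b} = ⊤) (hd : ∀ g, Commute d g) (h : a * b = b * a * d)
    {α β e t n : ℕ} (ha : a ^ p ^ α = 1) (hb : b ^ p ^ β = 1) (hda : d ^ p ^ e = a ^ p ^ t)
    (het : 2 * p ^ e ≤ p ^ t) (hn : p ^ α + p ^ β + 2 * p ^ e ≤ n + 3) :
    RingHom.ker (augmentation p G) ^ n = ⊥ := by
  set f := of (ZMod p) G
  have : CharP (MonoidAlgebra (ZMod p) G) p := charP_of_injective_algebraMap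
    (algebraMap (ZMod p) (MonoidAlgebra (ZMod p) G)).injective p
  have hpow (g : G) (m : ℕ) : (f g - 1) ^ p ^ m = f (g ^ p ^ m) - 1 := by
    rw [sub_pow_char_pow_of_commute p m (Commute.one_right _), one_pow, map_pow]
  have hC : ∀ x, Commute (f d - 1) x := by
    refine fun x => Commute.sub_left ?_ (Commute.one_left x)
    induction x using MonoidAlgebra.induction_linear with
    | zero => exact Commute.zero_right _
    | add x y hx hy => exact hx.add_right hy
    | single g r =>
      rw [commute_iff_eq]
      simp only [f, of_apply, single_mul_single, (hd g).eq, mul_one, one_mul]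
  have hAB : (f a - 1) * (f b - 1) =
      (f b - 1) * (f a - 1) + (1 + (f b - 1)) * (1 + (f a - 1)) * (f d - 1) := by
    have : f a * f b = f b * f a * f d := by simp only [← map_mul, h]
    rw [add_sub_cancel, add_sub_cancel, mul_sub (f b * f a), ← this]
    noncomm_ring
  have hbot : weightSpan (ZMod p) (f a - 1) (f b - 1) (f d - 1) n = ⊥ := by
    refine weightSpan_eq_bot (r := p ^ e) (s := p ^ t)
      (pow_pos (Fact.out : p.Prime).pos e) het (P := p ^ α) (Q := p ^ β) ?_ ?_ ?_ hn
    · rw [hpow, ha, map_one, sub_self]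
    · rw [hpow, hb, map_one, sub_self]
    · rw [hpow, hpow, hda]
  have hone : 1 ∈ weightSpan (ZMod p) (f a - 1) (f b - 1) (f d - 1) 0 := by
    simpa using monomial_mem_weightSpan (k := ZMod p) (f a - 1) (f b - 1) (f d - 1)
      (n := 0) (i := 0) (j := 0) (l := 0) le_rfl
  refine eq_bot_iff.2 fun x hx => ?_
  have hx' := pow_ker_augmentation_le hgen
    (weightSpan (ZMod p) (f a - 1) (f b - 1) (f d - 1)) (weightSpan_antitone _ _ _)
    hone
    (fun n w hw => left_mul_mem_weightSpan hC hAB hw) (fun n w hw => right_mul_mem_weightSpan hw)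
    n hx
  rwa [hbot] at hx'

theorem eq_one_of_mul_eq_one_of_disjoint {H K : Subgroup G} (h : Disjoint H K) {x y : G}
    (hx : x ∈ H) (hy : y ∈ K) (hxy : x * y = 1) : x = 1 ∧ y = 1 := by
  have hx1 : x = 1 := Subgroup.disjoint_def.1 h hx (by
    rw [eq_inv_of_mul_eq_one_left hxy]; exact inv_mem hy)
  subst hx1
  exact ⟨rfl, by simpa using hxy⟩

theorem dvd_of_isComplement' {a b : G} {N : Subgroup G} (haN : a ∈ N)
    (hN : Subgroup.IsComplement' N (Subgroup.zpowers b)) (j i : ℕ) (h : b ^ j * a ^ i = 1) :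
    orderOf b ∣ j ∧ orderOf a ∣ i := by
  obtain ⟨h1, h2⟩ := eq_one_of_mul_eq_one_of_disjoint hN.disjoint.symm
    (Subgroup.npow_mem_zpowers b j) (pow_mem haN i) h
  exact ⟨orderOf_dvd_of_pow_eq_one h1, orderOf_dvd_of_pow_eq_one h2⟩

theorem closure_pair_eq_top {a b : G} {N : Subgroup G} (hN : N ≤ Subgroup.closure {a, b})
    (h : Subgroup.IsComplement' N (Subgroup.zpowers b)) : Subgroup.closure {a, b} = ⊤ := by
  rw [eq_top_iff, ← h.sup_eq_top]
  exact sup_le hN (Subgroup.zpowers_le.2 (Subgroup.subset_closure (by simp)))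

end TwoGenerators

/-! ### The three families of groups -/

/-- Treats cases 1 and 3 together: with c of order p, d^p = a^(p^(t+1)), and t ≥ 1 gives 2p ≤
p^(t+1). -/
theorem orderedDavenport_eq_loewyLength_of_isInternalProduct {p : ℕ} [Fact p.Prime] (hp : Odd p)
    {G : Type*} [Group G] [Finite G] {a b c : G} {α β t : ℕ} (hα : 1 ≤ α) (ht : 1 ≤ t)
    (habc : IsInternalProduct a b c) (hd : ∀ g, Commute (grpComm a b) g)
    (hab : grpComm a b = a ^ p ^ t * c) (ha : orderOf a = p ^ α) (hb : orderOf b = p ^ β)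
    (hc : orderOf c = p) : orderedDavenport G = loewyLength p G := by
  have hpp := (Fact.out : p.Prime)
  have haN : a ∈ Subgroup.zpowers c ⊔ Subgroup.zpowers a :=
    Subgroup.mem_sup_right (Subgroup.mem_zpowers a)
  have hcN : c ∈ Subgroup.zpowers c ⊔ Subgroup.zpowers a :=
    Subgroup.mem_sup_left (Subgroup.mem_zpowers c)
  have hdpow (w : ℕ) : grpComm a b ^ w = a ^ (p ^ t * w) * c ^ w := by
    rw [hab, (habc.commute.symm.pow_left _).mul_pow, pow_mul]
  have hgen : Subgroup.closure {a, b} = ⊤ := by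
    refine closure_pair_eq_top (sup_le ?_ ?_) habc.isComplement <;> rw [Subgroup.zpowers_le]
    · have hac : a ∈ Subgroup.closure {a, b} := Subgroup.subset_closure (by simp)
      have hbc : b ∈ Subgroup.closure {a, b} := Subgroup.subset_closure (by simp)
      rw [eq_inv_mul_of_mul_eq hab.symm]
      exact mul_mem (inv_mem (pow_mem hac _))
        (mul_mem (mul_mem (mul_mem (inv_mem hac) (inv_mem hbc)) hac) hbc)
    · exact Subgroup.subset_closure (by simp)
  have hrel (u v w : ℕ) (h : b ^ u * a ^ v * grpComm a b ^ w = 1) : p ∣ v ∧ p ∣ w := by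
    rw [hdpow, mul_assoc, ← mul_assoc (a ^ v), ← pow_add] at h
    obtain ⟨-, h1⟩ := eq_one_of_mul_eq_one_of_disjoint habc.isComplement.disjoint.symm
      (Subgroup.npow_mem_zpowers b u) (mul_mem (pow_mem haN _) (pow_mem hcN w)) h
    obtain ⟨h2, h3⟩ := eq_one_of_mul_eq_one_of_disjoint habc.disjoint.symm
      (Subgroup.npow_mem_zpowers a _) (Subgroup.npow_mem_zpowers c w) h1
    have h4 : p ∣ v + p ^ t * w :=
      (dvd_pow_self p (by omega)).trans (ha ▸ orderOf_dvd_of_pow_eq_one h2)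
    exact ⟨(Nat.dvd_add_left ((dvd_pow_self p (by omega)).mul_right w)).1 h4,
      hc ▸ orderOf_dvd_of_pow_eq_one h3⟩
  obtain ⟨z, hz⟩ := exists_natCast_one_sub_not_isSquare hp
  obtain ⟨e, he⟩ : ∃ e, 2 * e = p + 1 := by
    obtain ⟨r, rfl⟩ := hp
    exact ⟨r + 1, by ring⟩
  have hba := dvd_of_isComplement' haN habc.isComplement
  rw [ha, hb] at hba
  have hαpos := pow_pos hpp.pos α
  have hβpos := pow_pos hpp.pos β
  refine orderedDavenport_eq_loewyLength (fun T hT => eq_nil_of_sublist_four_blocks hd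
    (mul_eq_mul_mul_grpComm a b) hrel hba hαpos hβpos hz he hT) ?_
  refine pow_ker_augmentation_eq_bot (e := 1) (t := t + 1) hgen hd (mul_eq_mul_mul_grpComm a b)
    (ha ▸ pow_orderOf_eq_one a) (hb ▸ pow_orderOf_eq_one b) ?_ ?_ ?_
  · rw [hdpow, pow_one, ← hc, pow_orderOf_eq_one, mul_one, pow_succ]
  · rw [pow_one, pow_succ]
    exact Nat.mul_le_mul_right p (hpp.two_le.trans (Nat.le_self_pow (by omega) p))
  · simp only [List.length_append, List.length_replicate, pow_one]
    have := hpp.pos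
    omega

/-- Here d is itself a power of a, so C = A^(p^(α-γ)) with exponent at least 2, and C adds nothing
to the maximal weight. -/
theorem orderedDavenport_eq_loewyLength_of_isTypeG₂ {p : ℕ} [Fact p.Prime]
    {G : Type*} [Group G] [Finite G] {α β γ : ℕ} (hcomm : ∀ a b g : G, Commute (grpComm a b) g)
    (h : IsTypeG₂ p α β γ G) : orderedDavenport G = loewyLength p G := by
  obtain ⟨hα, -, hγ, a, b, -, hab, hd, ha, hb, -⟩ := h
  have hpp := (Fact.out : p.Prime)
  have hba := dvd_of_isComplement' (Subgroup.mem_zpowers a) hab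
  rw [ha, hb] at hba
  have hαpos := pow_pos hpp.pos α
  have hβpos := pow_pos hpp.pos β
  refine orderedDavenport_eq_loewyLength
    (fun T hT => eq_nil_of_sublist_two_blocks hba hαpos hβpos hT) ?_
  refine pow_ker_augmentation_eq_bot (e := 0) (t := α - γ)
    (closure_pair_eq_top (Subgroup.zpowers_le.2 (Subgroup.subset_closure (by simp))) hab)
    (hcomm a b) (mul_eq_mul_mul_grpComm a b)
    (ha ▸ pow_orderOf_eq_one a) (hb ▸ pow_orderOf_eq_one b) ?_ ?_ ?_
  · rw [pow_zero, pow_one, hd]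
  · rw [pow_zero, mul_one]
    exact hpp.two_le.trans (Nat.le_self_pow (by omega) p)
  · simp only [List.length_append, List.length_replicate, pow_zero]
    omega

theorem theorem1p5 (p : ℕ) [Fact p.Prime] (hp : Odd p)
    (G : Type*) [Group G] [Finite G] (hG : IsPGroup p G)
    (hgen : ∃ x y : G, Subgroup.closure {x, y} = ⊤)
    (hnil : Group.IsNilpotent G) (hclass : Group.nilpotencyClass G = 2)
    (h : (∃ α β γ : ℕ, γ = 1 ∧ IsTypeG₁ p α β γ G) ∨
      (∃ α β γ : ℕ, IsTypeG₂ p α β γ G) ∨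
      (∃ α β γ σ : ℕ, σ = 1 ∧ IsTypeG₃ p α β γ σ G)) :
    orderedDavenport G = loewyLength p G := by
  have hcomm : ∀ a b g : G, Commute (grpComm a b) g := commute_grpComm_of_nilpotencyClass_eq_two hclass
  rcases h with ⟨α, β, γ, rfl, hβα, hγβ, -, a, b, c, habc, hc, -, -, ha, hb, hoc⟩ |
    ⟨α, β, γ, h⟩ | ⟨α, β, γ, σ, rfl, hγβ, hσγ, -, hα, a, b, c, habc, hd, -, ha, hb, hoc⟩
  -- Taking t = α makes a^(p^t) trivial, so [a,b] = c has the required shape.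
  · refine orderedDavenport_eq_loewyLength_of_isInternalProduct (t := α) hp (by omega) (by omega)
      habc (hcomm a b) ?_ ha hb (by simpa using hoc)
    rw [← ha, pow_orderOf_eq_one, one_mul, hc]
  · exact orderedDavenport_eq_loewyLength_of_isTypeG₂ hcomm h
  · exact orderedDavenport_eq_loewyLength_of_isInternalProduct (t := α - γ) hp (by omega)
      (by omega) habc (hcomm a b) hd ha hb (by simpa using hoc)
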